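/- Let $G$ be a (finite-dimensional, real) Lie group and $M$ a smooth finite-dimensional manifold without boundary, both Hausdorff with countable basis, and let $d$ be a metric on $M$ which induces the manifold topology of $M$. Let $G\times M\to M$, $(g,x)\mapsto gx$, be a smooth left action of $G$ on $M$ by isometries of $(M,d)$, and let $X\subset M$ be compact. Let $H_X=\{g\in G : gX=X\}$, let $\tau$ be the quotient topology on $G/H_X$, and let $d_X$ be the metric on $G/H_X$ given by $$d_X(gH_X,hH_X)=d_H(gX,hX),$$ where $d_H$ is the Hausdorff distance of $(M,d)$ (if $X=\emptyset$, then $G/H_X$ is a single point and $d_X=0$). Let $I\subset\mathbb R$ be an interval and let $\gamma:I\to G/H_X$ be a map which is continuous with respect to the metric $d_X$. Then $\gamma$ is continuous with respect to the quotient topology $\tau$. -/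

import Mathlib

open scoped Manifold ContDiff Pointwise Topology

noncomputable section

/-- The isotropy subgroup `H_X = {g ∈ G | gX = X}` of a subset `X` of a `G`-space. -/
abbrev isotropySubgroup (G : Type*) {M : Type*} [Group G] [MulAction G M] (X : Set M) :
    Subgroup G :=
  MulAction.stabilizer G X

theorem mem_isotropySubgroup {G M : Type*} [Group G] [MulAction G M] (X : Set M) (g : G) :
    g ∈ isotropySubgroup G X ↔ (fun x => g • x) '' X = X :=
  Iff.rfl

/-- Cosets of `H_X` correspond to translates of `X`. -/
theorem mk_eq_mk_iff_smul_eq {G M : Type*} [Group G] [MulAction G M] (X : Set M) (g h : G) :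
    (g : G ⧸ isotropySubgroup G X) = h ↔ g • X = h • X := by
  rw [QuotientGroup.eq, MulAction.mem_stabilizer_iff, mul_smul, inv_smul_eq_iff, eq_comm]

/-- The function `d_X (gH_X, hH_X) = d_H (gX, hX)` on `G/H_X`, where `d_H` is the Hausdorff
distance of `(M, d)`. -/
def inducedHausdorffDist (G : Type*) {M : Type*} [Group G] [PseudoMetricSpace M] [MulAction G M]
    (X : Set M) (a b : G ⧸ isotropySubgroup G X) : ℝ :=
  Quotient.liftOn₂' a b (fun g h => Metric.hausdorffDist (g • X) (h • X)) (by
    intro g₁ h₁ g₂ h₂ hg hh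
    have e₁ : g₁ • X = g₂ • X := (mk_eq_mk_iff_smul_eq X g₁ g₂).1 (Quotient.sound' hg)
    have e₂ : h₁ • X = h₂ • X := (mk_eq_mk_iff_smul_eq X h₁ h₂).1 (Quotient.sound' hh)
    simp only [e₁, e₂])

theorem inducedHausdorffDist_mk {G M : Type*} [Group G] [PseudoMetricSpace M] [MulAction G M]
    (X : Set M) (g h : G) :
    inducedHausdorffDist G X (g : G ⧸ isotropySubgroup G X) (h : G ⧸ isotropySubgroup G X) =
      Metric.hausdorffDist (g • X) (h • X) :=
  rfl

theorem hausdorffEDist_smul_ne_top {G M : Type*} [Group G] [PseudoMetricSpace M] [MulAction G M]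
    [ContinuousConstSMul G M] {X : Set M} (hX : IsCompact X) (g h : G) :
    Metric.hausdorffEDist (g • X) (h • X) ≠ ⊤ := by
  rcases X.eq_empty_or_nonempty with rfl | hne
  · simp
  · exact Metric.hausdorffEDist_ne_top_of_nonempty_of_bounded hne.smul_set hne.smul_set
      (hX.smul g).isBounded (hX.smul h).isBounded

/-- The induced Hausdorff metric `d_X` on `G/H_X`, for a compact subset `X` and an action by
homeomorphisms. Its topology, the metric topology of `d_X`, is in general not the quotient
topology, so this is not an instance. -/
@[reducible]
def inducedHausdorffMetric (G : Type*) {M : Type*} [Group G] [MetricSpace M] [MulAction G M]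
    [ContinuousConstSMul G M] (X : Set M) (hX : IsCompact X) :
    MetricSpace (G ⧸ isotropySubgroup G X) where
  dist := inducedHausdorffDist G X
  dist_self a := by
    induction a using QuotientGroup.induction_on with | _ g => ?_
    exact Metric.hausdorffDist_self_zero
  dist_comm a b := by
    induction a using QuotientGroup.induction_on with | _ g => ?_
    induction b using QuotientGroup.induction_on with | _ h => ?_
    exact Metric.hausdorffDist_comm
  dist_triangle a b c := by
    induction a using QuotientGroup.induction_on with | _ g => ?_
    induction b using QuotientGroup.induction_on with | _ h => ?_
    induction c using QuotientGroup.induction_on with | _ k => ?_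
    exact Metric.hausdorffDist_triangle (hausdorffEDist_smul_ne_top hX g h)
  eq_of_dist_eq_zero {a b} := by
    induction a using QuotientGroup.induction_on with | _ g => ?_
    induction b using QuotientGroup.induction_on with | _ h => ?_
    intro hd
    rw [mk_eq_mk_iff_smul_eq]
    exact ((hX.smul g).isClosed.hausdorffDist_zero_iff_eq (hX.smul h).isClosed
      (hausdorffEDist_smul_ne_top hX g h)).1 hd

/-- The topology on `G/H_X` induced by the metric `d_X`. -/
@[reducible]
def inducedHausdorffTopology (G : Type*) {M : Type*} [Group G] [MetricSpace M] [MulAction G M]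
    [ContinuousConstSMul G M] (X : Set M) (hX : IsCompact X) :
    TopologicalSpace (G ⧸ isotropySubgroup G X) :=
  (inducedHausdorffMetric G X hX).toUniformSpace.toTopologicalSpace

end

open Set Filter Metric

/-! The identity from `G/H_X` with the quotient topology to `(G/H_X, d_X)` is a continuous
injection, but its inverse may be discontinuous. By homogeneity, every point has a compact
neighbourhood whose frontier is at `d_X`-distance at least a fixed `r` from it. Hence a `d_X`-ball
`B` of radius `r / 3` meets each such neighbourhood in a relatively clopen set, and countably many
of these partition `B` into compact, so `d_X`-closed, pieces. By Sierpiński's theorem a path in `B`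
stays in one piece, and on a compact piece the two topologies agree. -/

/-- **Sierpiński's theorem** on countable closed partitions, for locally connected spaces: a
connected, locally connected, locally compact Hausdorff space that is a disjoint union of
countably many closed sets is equal to one of them. -/
theorem exists_eq_univ_of_iUnion_isClosed {S : Type*} [TopologicalSpace S] [T2Space S]
    [LocallyCompactSpace S] [LocallyConnectedSpace S] [ConnectedSpace S] {ι : Type*} [Countable ι]
    {C : ι → Set S} (hC : ∀ i, IsClosed (C i)) (hdisj : Pairwise (Function.onFun Disjoint C))
    (hcov : ⋃ i, C i = univ) : ∃ i, C i = univ := by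
  have huniq : ∀ {i j x}, x ∈ C i → x ∈ C j → i = j := fun {i j x} hi hj => by
    by_contra hij
    exact disjoint_left.1 (hdisj hij) hi hj
  have hmem : ∀ x, ∃ i, x ∈ C i := fun x => mem_iUnion.1 (hcov ▸ mem_univ x)
  -- The points near which the partition is not locally constant; Baire is applied to `K` itself.
  set K : Set S := (⋃ i, interior (C i))ᶜ with hK
  have hKc : IsClosed K := (isOpen_iUnion fun _ => isOpen_interior).isClosed_compl
  rcases K.eq_empty_or_nonempty with hKe | hKne
  · have hint : ∀ i, C i ⊆ interior (C i) := fun i x hx => by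
      have hx' : x ∈ ⋃ i, interior (C i) := by
        by_contra h
        exact (hKe ▸ (show x ∈ K from h) : x ∈ (∅ : Set S))
      obtain ⟨j, hj⟩ := mem_iUnion.1 hx'
      rwa [huniq hx (interior_subset hj)]
    obtain ⟨i, hi⟩ := hmem (Classical.arbitrary S)
    have hopen : IsOpen (C i) := subset_interior_iff_isOpen.1 (hint i)
    exact ⟨i, IsClopen.eq_univ ⟨hC i, hopen⟩ ⟨_, hi⟩⟩
  · exfalso
    have : Nonempty K := hKne.to_subtype
    have : LocallyCompactSpace K := hKc.isClosedEmbedding_subtypeVal.locallyCompactSpace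
    obtain ⟨n, z, hz⟩ := nonempty_interior_of_iUnion_of_closed
      (f := fun i => (Subtype.val ⁻¹' C i : Set K))
      (fun i => (hC i).preimage continuous_subtype_val)
      (by rw [← preimage_iUnion, hcov, preimage_univ])
    obtain ⟨O, hO, hOz⟩ := mem_nhds_subtype K z _ |>.1 (mem_interior_iff_mem_nhds.1 hz)
    obtain ⟨V, hVO, hVo, hzV, hVc⟩ :=
      locallyConnectedSpace_iff_subsets_isOpen_isConnected.1 inferInstance (z : S) O hO
    have hVK : ∀ y ∈ V, y ∈ K → y ∈ C n := fun y hy hyK =>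
      hOz (show (⟨y, hyK⟩ : K) ∈ Subtype.val ⁻¹' O from hVO hy)
    have hzn : (z : S) ∈ C n := hVK _ hzV z.2
    have hVn : V ⊆ C n := by
      intro y hy
      obtain ⟨m, hm⟩ := hmem y
      by_contra hyn
      have hmn : m ≠ n := fun h => hyn (h ▸ hm)
      -- Inside `V`, a piece other than `C n` misses `K`, so it is relatively clopen; it omits `z`,
      -- contradicting connectedness of `V`.
      have hsub : ∀ x ∈ V, x ∈ C m → x ∈ interior (C m) := fun x hx hxm => by
        have hx' : x ∈ ⋃ i, interior (C i) := by
          by_contra h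
          exact hmn (huniq hxm (hVK x hx h))
        obtain ⟨j, hj⟩ := mem_iUnion.1 hx'
        rwa [huniq hxm (interior_subset hj)]
      obtain ⟨x, -, hx1, hx2⟩ := hVc.isPreconnected (interior (C m)) (C m)ᶜ isOpen_interior
        (hC m).isOpen_compl (fun x hx => by
          by_cases h : x ∈ C m
          · exact Or.inl (hsub x hx h)
          · exact Or.inr h)
        ⟨y, hy, hsub y hy hm⟩ ⟨z, hzV, fun h => hmn (huniq h hzn)⟩
      exact hx2 (interior_subset hx1)
    exact z.2 (mem_iUnion.2 ⟨n, interior_maximal hVn hVo hzV⟩)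

/-- The frontier is compact, so its image is closed in the metric topology and, by injectivity,
omits the centre. -/
theorem exists_pos_forall_frontier_le_dist {Q Y : Type*} [TopologicalSpace Q] [MetricSpace Y]
    {ρ : Q → Y} (hρ : Continuous ρ) (hinj : Function.Injective ρ) {x : Q} {W : Set Q}
    (hWc : IsCompact W) (hW : W ∈ 𝓝 x) :
    ∃ r > 0, ∀ y ∈ frontier W, r ≤ dist (ρ x) (ρ y) := by
  have : T2Space Q := T2Space.of_injective_continuous hinj hρ
  have hFc : IsCompact (frontier W) :=
    hWc.of_isClosed_subset isClosed_frontier hWc.isClosed.frontier_subset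
  obtain ⟨r, hr, hball⟩ := Metric.isOpen_iff.1 (hFc.image hρ).isClosed.isOpen_compl (ρ x) (by
    rintro ⟨y, hy, hyx⟩
    rw [hinj hyx] at hy
    exact hy.2 (mem_interior_iff_mem_nhds.2 hW))
  refine ⟨r, hr, fun y hy => le_of_not_gt fun hlt => hball ?_ (mem_image_of_mem ρ hy)⟩
  rwa [mem_ball, dist_comm]

/-- A path in `Q` that is continuous for a coarser metric topology is continuous, provided that
`Q` has compact neighbourhoods whose frontiers stay uniformly away from the centre. -/
theorem continuous_of_continuous_comp_of_frontier {Q Y : Type*} [TopologicalSpace Q]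
    [SecondCountableTopology Q] [MetricSpace Y] {ρ : Q → Y} (hρ : Continuous ρ)
    (hinj : Function.Injective ρ) {r : ℝ} (hr : 0 < r) {W : Q → Set Q}
    (hWc : ∀ x, IsCompact (W x)) (hW : ∀ x, W x ∈ 𝓝 x)
    (hfr : ∀ x, ∀ y ∈ frontier (W x), r ≤ dist (ρ x) (ρ y))
    {I : Set ℝ} (hI : I.OrdConnected) {γ : I → Q} (hγ : Continuous (ρ ∘ γ)) : Continuous γ := by
  have : T2Space Q := T2Space.of_injective_continuous hinj hρ
  rw [continuous_iff_continuousAt]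
  intro t₀
  -- Points of `B` are at most `2r/3 < r` apart, so `B` avoids the frontier of `W y` for every `y ∈
  -- B`.
  set B : Set Q := {q | dist (ρ q) (ρ (γ t₀)) ≤ r / 3} with hB
  have hBc : IsClosed B := isClosed_le (by fun_prop) continuous_const
  have hx₀ : γ t₀ ∈ B := by simp only [hB, mem_ofPred_eq, dist_self]; positivity
  have hint : ∀ y ∈ B, ∀ q ∈ B, q ∈ W y → q ∈ interior (W y) := by
    intro y hy q hq hqy
    by_contra h
    have h1 := hfr y q ⟨subset_closure hqy, h⟩
    have h2 := dist_triangle_right (ρ y) (ρ q) (ρ (γ t₀))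
    simp only [hB, mem_ofPred_eq] at hy hq
    linarith
  obtain ⟨T, hTB, hTc, hT⟩ := TopologicalSpace.countable_cover_nhdsWithin (s := B) (f := W)
    fun x _ => mem_nhdsWithin_of_mem_nhds (hW x)
  have hTne : T.Nonempty := by
    obtain ⟨y, hy, -⟩ := mem_iUnion₂.1 (hT hx₀)
    exact ⟨y, hy⟩
  obtain ⟨y, rfl⟩ := hTc.exists_eq_range hTne
  have hyB : ∀ n, y n ∈ B := fun n => hTB (mem_range_self n)
  have hBcov : ∀ q ∈ B, ∃ n, q ∈ W (y n) := fun q hq => by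
    obtain ⟨_, ⟨n, rfl⟩, hn⟩ := mem_iUnion₂.1 (hT hq)
    exact ⟨n, hn⟩
  -- Removing interiors keeps the pieces compact; within `B` it is the same as removing the sets `W
  -- (y m)` themselves.
  let A : ℕ → Set Q := fun n => W (y n) ∩ (B ∩ (⋃ m < n, interior (W (y m)))ᶜ)
  have hAc : ∀ n, IsCompact (A n) := fun n => (hWc _).inter_right
    (hBc.inter (isOpen_biUnion fun _ _ => isOpen_interior).isClosed_compl)
  have hAlt : ∀ m n q, m < n → q ∈ A m → q ∉ A n := fun m n q hmn hm hn =>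
    hn.2.2 (mem_iUnion₂.2 ⟨m, hmn, hint _ (hyB m) q hm.2.1 hm.1⟩)
  have hAdisj : ∀ m n q, q ∈ A m → q ∈ A n → m = n := fun m n q hm hn => by
    rcases lt_trichotomy m n with h | h | h
    · exact (hAlt m n q h hm hn).elim
    · exact h
    · exact (hAlt n m q h hn hm).elim
  have hAcov : ∀ q ∈ B, ∃ n, q ∈ A n := fun q hq => by
    classical
    refine ⟨Nat.find (hBcov q hq), Nat.find_spec (hBcov q hq), hq, fun h => ?_⟩
    obtain ⟨m, hm, hqm⟩ := mem_iUnion₂.1 h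
    exact Nat.find_min (hBcov q hq) hm (interior_subset hqm)
  obtain ⟨n₀, hn₀⟩ := hAcov _ hx₀
  obtain ⟨δ, hδ, hδB⟩ := Metric.continuous_iff.1 hγ t₀ (r / 3) (by positivity)
  have hloc : ∀ᶠ t in 𝓝 t₀, γ t ∈ A n₀ := by
    filter_upwards [ball_mem_nhds t₀ hδ] with t ht
    have hle : min (t₀ : ℝ) t ≤ max (t₀ : ℝ) t := min_le_max
    have hJ : ∀ u : Icc (min (t₀ : ℝ) t) (max (t₀ : ℝ) t), (u : ℝ) ∈ I := fun u =>
      hI.uIcc_subset t₀.2 t.2 u.2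
    -- Clamping to the segment between `t₀` and `t` lets Sierpiński's theorem be applied on all of
    -- `ℝ`.
    let p : ℝ → I := fun u => ⟨projIcc _ _ hle u, hJ _⟩
    have hp : Continuous p := (continuous_subtype_val.comp continuous_projIcc).subtype_mk _
    have hpt : ∀ u (hu : u ∈ I), u ∈ uIcc (t₀ : ℝ) t → p u = ⟨u, hu⟩ := fun u _ huI =>
      Subtype.ext (show (projIcc _ _ hle u : ℝ) = u by rw [projIcc_of_mem hle huI])
    have hpB : ∀ u, γ (p u) ∈ B := fun u => by
      refine (hδB (p u) ?_).le
      have h1 := abs_sub_left_of_mem_uIcc (projIcc _ _ hle u).2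
      refine lt_of_le_of_lt ?_ ht
      rw [Subtype.dist_eq, Subtype.dist_eq, Real.dist_eq, Real.dist_eq]
      exact h1
    obtain ⟨n, hn⟩ := exists_eq_univ_of_iUnion_isClosed (C := fun n => {u | γ (p u) ∈ A n})
      (fun n => by
        have : {u | γ (p u) ∈ A n} = (ρ ∘ γ ∘ p) ⁻¹' (ρ '' A n) := by
          ext u
          simp [hinj.eq_iff]
        rw [this]
        exact ((hAc n).image hρ).isClosed.preimage (hγ.comp hp))
      (fun m n hmn => disjoint_left.2 fun u hm hn => hmn (hAdisj m n _ hm hn))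
      (eq_univ_of_forall fun u => mem_iUnion.2 (hAcov _ (hpB u)))
    have h0 : γ (p t₀) ∈ A n := (hn ▸ mem_univ _ : (t₀ : ℝ) ∈ {u | γ (p u) ∈ A n})
    have h1 : γ (p t) ∈ A n := (hn ▸ mem_univ _ : (t : ℝ) ∈ {u | γ (p u) ∈ A n})
    rw [hpt _ t₀.2 left_mem_uIcc] at h0
    rw [hpt _ t.2 right_mem_uIcc] at h1
    rwa [hAdisj _ _ _ hn₀ h0]
  -- In the compact `A n₀`, any cluster point `q` has `ρ q = ρ (γ t₀)`.
  refine (hAc n₀).tendsto_nhds_of_unique_mapClusterPt hloc fun q _ hq => hinj ?_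
  have h1 : MapClusterPt (ρ q) (𝓝 t₀) (ρ ∘ γ) := hq.continuousAt_comp hρ.continuousAt
  have h2 : Tendsto (ρ ∘ γ) (𝓝 t₀) (𝓝 (ρ (γ t₀))) := hγ.tendsto t₀
  by_contra hne
  exact (disjoint_nhds_nhds.2 hne).le_bot.not_gt
    (bot_lt_iff_ne_bot.2 (h1.neBot.mono (inf_le_inf_left _ h2)).ne)

/-- The induced Hausdorff distance is invariant under left translations. -/
theorem inducedHausdorffDist_smul {G M : Type*} [Group G] [PseudoMetricSpace M] [MulAction G M]
    [IsIsometricSMul G M] (X : Set M) (k : G) (a b : G ⧸ isotropySubgroup G X) :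
    inducedHausdorffDist G X (k • a) (k • b) = inducedHausdorffDist G X a b := by
  induction a using QuotientGroup.induction_on with | _ g => ?_
  induction b using QuotientGroup.induction_on with | _ h => ?_
  rw [MulAction.Quotient.smul_coe, MulAction.Quotient.smul_coe, inducedHausdorffDist_mk,
    inducedHausdorffDist_mk, smul_eq_mul, smul_eq_mul, mul_smul, mul_smul]
  exact hausdorffDist_image (isometry_smul M k)

/-- For a continuous action, the induced Hausdorff topology is coarser than the quotient
topology. -/
theorem continuous_id_inducedHausdorffTopology {G M : Type*} [Group G] [TopologicalSpace G]
    [MetricSpace M] [MulAction G M] [ContinuousSMul G M] (X : Set M) (hX : IsCompact X) :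
    Continuous[inferInstance, inducedHausdorffTopology G X hX]
      (id : G ⧸ isotropySubgroup G X → G ⧸ isotropySubgroup G X) := by
  refine continuous_coinduced_dom.2 ?_
  refine (@continuous_iff_continuousAt _ _ _ (inducedHausdorffTopology G X hX) _).2 fun g =>
    (@Metric.tendsto_nhds _ _ (inducedHausdorffMetric G X hX).toPseudoMetricSpace _ _ _).2
      fun ε hε => ?_
  have key : ∀ᶠ h in 𝓝 g, ∀ x ∈ X, dist (h • x) (g • x) < ε / 2 :=
    hX.eventually_forall_of_forall_eventually fun x _ => by
      have hc : Continuous fun p : G × M => dist (p.1 • p.2) (g • p.2) := by fun_prop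
      exact hc.continuousAt.eventually_lt continuousAt_const (by simpa using hε)
  filter_upwards [key] with h hh
  refine lt_of_le_of_lt (hausdorffDist_le_of_mem_dist (half_pos hε).le ?_ ?_) (half_lt_self hε)
  · rintro _ ⟨x, hx, rfl⟩
    exact ⟨g • x, smul_mem_smul_set hx, (hh x hx).le⟩
  · rintro _ ⟨x, hx, rfl⟩
    exact ⟨h • x, smul_mem_smul_set hx, by rw [dist_comm]; exact (hh x hx).le⟩

/-- For a continuous isometric action of a locally compact, second countable group, paths that are
continuous for the induced Hausdorff metric are continuous for the quotient topology. -/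
theorem continuous_of_continuous_inducedHausdorffTopology {G M : Type*} [Group G]
    [TopologicalSpace G] [IsTopologicalGroup G] [LocallyCompactSpace G]
    [SecondCountableTopology G] [MetricSpace M] [MulAction G M] [IsIsometricSMul G M]
    [ContinuousSMul G M] (X : Set M) (hX : IsCompact X) {I : Set ℝ} (hI : I.OrdConnected)
    (γ : I → G ⧸ isotropySubgroup G X)
    (hγ : Continuous[instTopologicalSpaceSubtype, inducedHausdorffTopology G X hX] γ) :
    Continuous γ := by
  have hid := continuous_id_inducedHausdorffTopology (G := G) X hX
  obtain ⟨W₀, hW₀c, hW₀⟩ := exists_compact_mem_nhds ((1 : G) : G ⧸ isotropySubgroup G X)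
  obtain ⟨r, hr, hfr⟩ : ∃ r > 0, ∀ y ∈ frontier W₀,
      r ≤ inducedHausdorffDist G X ((1 : G) : G ⧸ isotropySubgroup G X) y :=
    @exists_pos_forall_frontier_le_dist _ _ _ (inducedHausdorffMetric G X hX) id hid
      Function.injective_id _ _ hW₀c hW₀
  have hout : ∀ x : G ⧸ isotropySubgroup G X, x.out • ((1 : G) : G ⧸ isotropySubgroup G X) = x :=
    fun x => by rw [MulAction.Quotient.smul_coe, smul_eq_mul, mul_one, QuotientGroup.out_eq']
  -- Translating `W₀` by isometries of `d_X` makes `r` uniform.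
  refine @continuous_of_continuous_comp_of_frontier _ _ _ _ (inducedHausdorffMetric G X hX) id hid
    Function.injective_id r hr (fun x => x.out • W₀) (fun x => hW₀c.smul _) (fun x => ?_)
    (fun x y hy => ?_) I hI γ hγ
  · have := smul_mem_nhds_smul x.out hW₀
    rwa [hout] at this
  · have hy' : y ∈ x.out • frontier W₀ := by
      exact ((Homeomorph.smul x.out).image_frontier W₀).ge hy
    obtain ⟨z, hz, rfl⟩ := hy'
    refine (hfr z hz).trans_eq ?_
    rw [← inducedHausdorffDist_smul X x.out, hout]
    rfl

theorem mainTheorem5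
    {E : Type*} [NormedAddCommGroup E] [NormedSpace ℝ E] [FiniteDimensional ℝ E]
    {G : Type*} [Group G] [TopologicalSpace G] [T2Space G] [SecondCountableTopology G]
    [ChartedSpace E G] [LieGroup 𝓘(ℝ, E) ∞ G]
    {F : Type*} [NormedAddCommGroup F] [NormedSpace ℝ F] [FiniteDimensional ℝ F]
    {M : Type*} [MetricSpace M] [SecondCountableTopology M]
    [ChartedSpace F M] [IsManifold 𝓘(ℝ, F) ∞ M]
    [MulAction G M] [IsIsometricSMul G M]
    (hsmooth : ContMDiff (𝓘(ℝ, E).prod 𝓘(ℝ, F)) 𝓘(ℝ, F) ∞ (fun p : G × M => p.1 • p.2))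
    (X : Set M) (hX : IsCompact X)
    (I : Set ℝ) (hI : I.OrdConnected)
    (γ : I → G ⧸ isotropySubgroup G X)
    (hγ : Continuous[instTopologicalSpaceSubtype, inducedHausdorffTopology G X hX] γ) :
    Continuous γ := by
  have : IsTopologicalGroup G := topologicalGroup_of_lieGroup 𝓘(ℝ, E) ∞
  have : LocallyCompactSpace G := ChartedSpace.locallyCompactSpace E G
  have : ContinuousSMul G M := ⟨hsmooth.continuous⟩
  exact continuous_of_continuous_inducedHausdorffTopology X hX hI γ hγ
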